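/- Let $\mathbb{C}P^1$ be the complex projective line with the Fubini-Study metric, normalized to have total area $1$: in the affine coordinate $w = z_1/z_0$ on $\{[z_0:z_1] : z_0 \neq 0\}$ its fundamental form is $$\omega_{FS} = \frac{\sqrt{-1}}{2\pi}\,\partial\bar\partial \log(1+|w|^2) = \frac{\sqrt{-1}}{2\pi}\,\frac{dw\wedge d\bar w}{(1+|w|^2)^2}.$$ For a holomorphic map $f:\mathbb{C}\to\mathbb{C}P^1$ let $|df|(z)\ge 0$ be the norm of its differential with respect to the Euclidean metric on $\mathbb{C}$ and the Fubini-Study metric, i.e. the length of the tangent vector $df(\partial/\partial x)$ at $f(z)$, so that $f^*\omega_{FS} = |df|^2\,dx\wedge dy$ (where $f$ is given by a finite value $w=f(z)$, $|df|^2(z) = \frac{|f'(z)|^2}{\pi(1+|f(z)|^2)^2}$). Let $\mathcal{M}(\mathbb{C}P^1)$ be the set of holomorphic maps $f:\mathbb{C}\to\mathbb{C}P^1$ with $|df|(z)\le 1$ for all $z\in\mathbb{C}$, and define the packing density of such an $f$ and the holomorphic capacity of $\mathbb{C}P^1$ by $$\rho(f) := \limsup_{R\to\infty}\frac{1}{\pi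 R^2}\int_{|z|\le R}|df|^2\,dx\,dy,\qquad \rho(\mathbb{C}P^1) := \sup_{f\in\mathcal{M}(\mathbb{C}P^1)}\rho(f).$$ Then $$\rho(\mathbb{C}P^1)\le 1-10^{-100}.$$ -/

import Mathlib

open scoped Manifold ContDiff LinearAlgebra.Projectivization ENNReal

noncomputable section

/-! ## Hermitian manifolds, holomorphic curves, packing density, holomorphic capacity -/

/-- A Hermitian metric on a complex manifold `X`: a Hermitian inner product on each (complex)
tangent space, whose coefficients are smooth in every local coordinate system of the manifold.
The associated Riemannian metric `g` is the real part of `inner`. -/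
structure HermitianMetric (E : Type*) [NormedAddCommGroup E] [NormedSpace ℂ E]
    [FiniteDimensional ℂ E] (X : Type*) [TopologicalSpace X] [ChartedSpace E X]
    [IsManifold 𝓘(ℂ, E) ω X] where
  /-- the Hermitian inner product on the tangent space at `x` -/
  inner (x : X) : TangentSpace 𝓘(ℂ, E) x →ₗ⋆[ℂ] TangentSpace 𝓘(ℂ, E) x →ₗ[ℂ] ℂ
  conj_symm (x : X) (u v : TangentSpace 𝓘(ℂ, E) x) :
    (starRingEnd ℂ) (inner x u v) = inner x v u
  pos_def (x : X) (v : TangentSpace 𝓘(ℂ, E) x) : v ≠ 0 → 0 < (inner x v v).re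
  smooth (x₀ : X) (a b : E) :
    ContDiffOn ℝ ∞
      (fun u : E ↦ inner ((chartAt E x₀).symm u)
        (mfderiv 𝓘(ℂ, E) 𝓘(ℂ, E) (chartAt E x₀).symm u a)
        (mfderiv 𝓘(ℂ, E) 𝓘(ℂ, E) (chartAt E x₀).symm u b))
      (chartAt E x₀).target

section General

variable {E : Type*} [NormedAddCommGroup E] [NormedSpace ℂ E] [FiniteDimensional ℂ E]
  {X : Type*} [TopologicalSpace X] [ChartedSpace E X] [IsManifold 𝓘(ℂ, E) ω X]

/-- The length `|v| = √ g(v, v)` of a real tangent vector `v`. -/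
def HermitianMetric.length (g : HermitianMetric E X) (x : X)
    (v : TangentSpace 𝓘(ℂ, E) x) : ℝ :=
  √ (g.inner x v v).re

/-- The norm `|df|(z) = √2 |df(∂/∂z)|` of the differential of a holomorphic curve `f : ℂ → X`.
As `df(∂/∂z) = (u - i J u) / 2` with `u = df(∂/∂x)`, and `g(J u, J u) = g(u, u)`, this is the
`g`-length of `u`, the image under the derivative of `f` of the unit vector `1 = ∂/∂x`. -/
def normDifferential (g : HermitianMetric E X) (f : ℂ → X) (z : ℂ) : ℝ :=
  g.length (f z) (mfderiv 𝓘(ℂ, ℂ) 𝓘(ℂ, E) f z (1 : ℂ))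

/-- The space `ℳ(X)` of holomorphic curves `f : ℂ → X` with `|df| ≤ 1`. -/
def holomorphicCurves (g : HermitianMetric E X) : Set (ℂ → X) :=
  {f | MDifferentiable 𝓘(ℂ, ℂ) 𝓘(ℂ, E) f ∧ ∀ z, normDifferential g f z ≤ 1}

/-- The packing density `ρ(f) = limsup_{R → ∞} (1 / (π R²)) ∫_{|z| ≤ R} |df|² dx dy`. -/
def packingDensity (g : HermitianMetric E X) (f : ℂ → X) : ℝ≥0∞ :=
  Filter.limsup
    (fun R : ℝ ↦ (∫⁻ z in Metric.closedBall (0 : ℂ) R,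
      ENNReal.ofReal (normDifferential g f z ^ 2)) / ENNReal.ofReal (Real.pi * R ^ 2))
    Filter.atTop

/-- The holomorphic capacity `ρ(X) = sup_{f ∈ ℳ(X)} ρ(f)`. -/
def holomorphicCapacity (g : HermitianMetric E X) : ℝ≥0∞ :=
  ⨆ f ∈ holomorphicCurves g, packingDensity g f

end General

/-! ## The complex projective line as a complex manifold -/

/-- The complex projective line: one-dimensional subspaces of `ℂ²`. -/
abbrev CP1 : Type := ℙ ℂ (Fin 2 → ℂ)

namespace CP1

/-- The quotient topology from `ℂ² ∖ {0}`. -/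
instance : TopologicalSpace CP1 :=
  TopologicalSpace.coinduced (Projectivization.mk' ℂ) inferInstance

lemma isQuotientMap_mk' :
    Topology.IsQuotientMap (Projectivization.mk' ℂ : {v : Fin 2 → ℂ // v ≠ 0} → CP1) :=
  ⟨⟨rfl⟩, fun x ↦ ⟨⟨x.rep, x.rep_nonzero⟩, x.mk_rep⟩⟩

/-- The affine coordinate `z_j / z_i` (where `{i, j} = {0, 1}`) of a point `[z₀ : z₁]`;
meaningful where `z_i ≠ 0`. -/
def coord (i : Fin 2) (x : CP1) : ℂ := x.rep i.rev / x.rep i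

/-- The open set `U_i = {[z₀ : z₁] | z_i ≠ 0}`. -/
def U (i : Fin 2) : Set CP1 := {x | x.rep i ≠ 0}

/-- The vector in `ℂ²` whose `i`-th entry is `1` and whose other entry is `u`. -/
def vec (i : Fin 2) (u : ℂ) : Fin 2 → ℂ := fun j ↦ if j = i then 1 else u

lemma vec_ne_zero (i : Fin 2) (u : ℂ) : vec i u ≠ 0 := fun h ↦ by
  simpa [vec] using congrFun h i

/-- The point `[1 : u]` (if `i = 0`) or `[u : 1]` (if `i = 1`). -/
def ofCoord (i : Fin 2) (u : ℂ) : CP1 := Projectivization.mk ℂ (vec i u) (vec_ne_zero i u)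

lemma mk_mem_U (i : Fin 2) (v : Fin 2 → ℂ) (hv : v ≠ 0) :
    Projectivization.mk ℂ v hv ∈ U i ↔ v i ≠ 0 := by
  obtain ⟨a, ha⟩ := Projectivization.exists_smul_eq_mk_rep ℂ v hv
  have : (Projectivization.mk ℂ v hv).rep i = a * v i := by rw [← ha]; rfl
  simp [U, this]

lemma coord_mk (i : Fin 2) (v : Fin 2 → ℂ) (hv : v ≠ 0) :
    coord i (Projectivization.mk ℂ v hv) = v i.rev / v i := by
  obtain ⟨a, ha⟩ := Projectivization.exists_smul_eq_mk_rep ℂ v hv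
  have h (j : Fin 2) : (Projectivization.mk ℂ v hv).rep j = a * v j := by rw [← ha]; rfl
  simp only [coord, h]
  exact mul_div_mul_left _ _ a.ne_zero

lemma ofCoord_mem_U (i : Fin 2) (u : ℂ) : ofCoord i u ∈ U i := by
  simp [ofCoord, mk_mem_U, vec]

lemma coord_ofCoord (i : Fin 2) (u : ℂ) : coord i (ofCoord i u) = u := by
  fin_cases i <;> simp [ofCoord, coord_mk, vec]

lemma ofCoord_coord (i : Fin 2) (x : CP1) (hx : x ∈ U i) : ofCoord i (coord i x) = x := by
  have hx' : x.rep i ≠ 0 := hx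
  conv_rhs => rw [← x.mk_rep]
  rw [ofCoord, Projectivization.mk_eq_mk_iff']
  refine ⟨(x.rep i)⁻¹, ?_⟩
  ext j
  fin_cases i <;> fin_cases j <;> simp_all [vec, coord, div_eq_inv_mul]

lemma isOpen_U (i : Fin 2) : IsOpen (U i) := by
  rw [← isQuotientMap_mk'.isOpen_preimage]
  have : Projectivization.mk' ℂ ⁻¹' U i = {v : {v : Fin 2 → ℂ // v ≠ 0} | v.1 i ≠ 0} := by
    ext v
    exact mk_mem_U i v.1 v.2
  rw [this]
  exact isOpen_ne_fun ((continuous_apply i).comp continuous_subtype_val) continuous_const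

lemma continuousOn_coord (i : Fin 2) : ContinuousOn (coord i) (U i) := by
  rw [isQuotientMap_mk'.continuousOn_isOpen_iff (isOpen_U i)]
  have : coord i ∘ Projectivization.mk' ℂ
      = fun v : {v : Fin 2 → ℂ // v ≠ 0} ↦ v.1 i.rev / v.1 i := by
    ext v
    exact coord_mk i v.1 v.2
  rw [this]
  refine ContinuousOn.div
    ((continuous_apply i.rev).comp continuous_subtype_val).continuousOn
    ((continuous_apply i).comp continuous_subtype_val).continuousOn fun v hv ↦ ?_
  exact (mk_mem_U i v.1 v.2).1 hv

lemma continuous_ofCoord (i : Fin 2) : Continuous (ofCoord i) := by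
  refine isQuotientMap_mk'.continuous.comp
    (f := fun u ↦ (⟨vec i u, vec_ne_zero i u⟩ : {v : Fin 2 → ℂ // v ≠ 0})) ?_
  refine Continuous.subtype_mk (continuous_pi fun j ↦ ?_) _
  unfold vec
  split_ifs <;> fun_prop

/-- The affine chart `U_i → ℂ`. -/
def chart (i : Fin 2) : OpenPartialHomeomorph CP1 ℂ where
  toFun := coord i
  invFun := ofCoord i
  source := U i
  target := Set.univ
  map_source' _ _ := Set.mem_univ _
  map_target' u _ := ofCoord_mem_U i u
  left_inv' x hx := ofCoord_coord i x hx
  right_inv' u _ := coord_ofCoord i u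
  open_source := isOpen_U i
  open_target := isOpen_univ
  continuousOn_toFun := continuousOn_coord i
  continuousOn_invFun := (continuous_ofCoord i).continuousOn

lemma mem_U_one_of_notMem_U_zero {x : CP1} (hx : x ∉ U 0) : x ∈ U 1 := by
  intro h1
  refine x.rep_nonzero (funext fun j ↦ ?_)
  have h0 : x.rep 0 = 0 := not_not.1 hx
  fin_cases j
  · exact h0
  · exact h1

open Classical in
/-- The index of the preferred chart at a point. -/
def idx (x : CP1) : Fin 2 := if x ∈ U 0 then 0 else 1

lemma mem_U_idx (x : CP1) : x ∈ U (idx x) := by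
  unfold idx
  split_ifs with h
  · exact h
  · exact mem_U_one_of_notMem_U_zero h

instance : ChartedSpace ℂ CP1 where
  atlas := Set.range chart
  chartAt x := chart (idx x)
  mem_chart_source := mem_U_idx
  chart_mem_atlas x := ⟨idx x, rfl⟩

lemma coord_ofCoord_of_ne {i j : Fin 2} (hij : i ≠ j) (u : ℂ) : coord j (ofCoord i u) = u⁻¹ := by
  fin_cases i <;> fin_cases j <;> simp_all [ofCoord, coord_mk, vec]

lemma ofCoord_mem_U_of_ne {i j : Fin 2} (hij : i ≠ j) (u : ℂ) :
    ofCoord i u ∈ U j ↔ u ≠ 0 := by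
  fin_cases i <;> fin_cases j <;> simp_all [ofCoord, mk_mem_U, vec]

instance : IsManifold 𝓘(ℂ, ℂ) ω CP1 := by
  refine isManifold_of_contDiffOn _ _ _ ?_
  rintro _ _ ⟨i, rfl⟩ ⟨j, rfl⟩
  by_cases hij : i = j
  · subst hij
    refine contDiffOn_id.congr fun u _ ↦ ?_
    exact coord_ofCoord i u
  · refine ContDiffOn.congr (f := fun u : ℂ ↦ u⁻¹) ?_ fun u _ ↦ coord_ofCoord_of_ne hij u
    refine (contDiffOn_inv ℂ).mono fun u hu ↦ ?_
    have h : ofCoord i u ∈ U j := by simpa [chart] using hu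
    exact (ofCoord_mem_U_of_ne hij u).1 h

/-! ## The Fubini-Study metric -/

/-- The coefficient of the Fubini-Study metric: in either affine coordinate `w`, the metric is
`|dw|² / (π (1 + |w|²)²)`, with fundamental form
`(i / 2π) ∂∂̄ log (1 + |w|²) = (i / 2π) dw ∧ dw̄ / (1 + |w|²)²`, of total mass `1`. -/
def fsCoeff (w : ℂ) : ℝ := (Real.pi * (1 + ‖w‖ ^ 2) ^ 2)⁻¹

lemma fsCoeff_pos (w : ℂ) : 0 < fsCoeff w := by
  unfold fsCoeff
  have := Real.pi_pos
  positivity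

lemma contDiff_fsCoeff : ContDiff ℝ ∞ fsCoeff := by
  have h : ContDiff ℝ ∞ fun w : ℂ ↦ Real.pi * (1 + ‖w‖ ^ 2) ^ 2 :=
    contDiff_const.mul ((contDiff_const.add (contDiff_norm_sq ℝ)).pow 2)
  refine h.inv fun w ↦ ?_
  have := Real.pi_pos
  positivity

/-- The Fubini-Study inner product on the tangent space at `x`, which is identified with `ℂ`
by the preferred chart at `x`. -/
def fsInner (x : CP1) :
    TangentSpace 𝓘(ℂ, ℂ) x →ₗ⋆[ℂ] TangentSpace 𝓘(ℂ, ℂ) x →ₗ[ℂ] ℂ :=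
  (((fsCoeff (coord (idx x) x) : ℝ) : ℂ) • innerₛₗ ℂ (E := ℂ) :)

lemma mfderiv_ofCoord (i : Fin 2) (u : ℂ) (a : ℂ) :
    (mfderiv 𝓘(ℂ, ℂ) 𝓘(ℂ, ℂ) (chart i).symm u a : ℂ) =
      if idx (ofCoord i u) = i then a else -(u ^ 2)⁻¹ * a := by
  have hmd : MDifferentiableAt 𝓘(ℂ, ℂ) 𝓘(ℂ, ℂ) (chart i).symm u :=
    mdifferentiableAt_atlas_symm (H := ℂ) (M := CP1) (Set.mem_range_self i) (Set.mem_univ u)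
  have hw : (writtenInExtChartAt 𝓘(ℂ, ℂ) 𝓘(ℂ, ℂ) u (chart i).symm : ℂ → ℂ) =
      fun w ↦ coord (idx (ofCoord i u)) (ofCoord i w) := by
    ext w
    simp [writtenInExtChartAt, extChartAt]
    rfl
  have hd : (mfderiv 𝓘(ℂ, ℂ) 𝓘(ℂ, ℂ) (chart i).symm u a : ℂ) =
      fderiv ℂ (fun w ↦ coord (idx (ofCoord i u)) (ofCoord i w)) u a := by
    rw [← hw, ← fderivWithin_univ]
    refine (DFunLike.congr_fun hmd.mfderiv a).trans ?_
    simp only [modelWithCornersSelf_coe, Set.range_id, extChartAt_self_apply]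
    rfl
  rw [hd]
  split_ifs with h
  · rw [h]
    simp only [coord_ofCoord]
    simp
    rfl
  · simp only [coord_ofCoord_of_ne (Ne.symm h)]
    simp [mul_comm]
    rfl

lemma fsInner_apply (x : CP1) (u v : ℂ) :
    fsInner x u v = (fsCoeff (coord (idx x) x) : ℂ) * ((starRingEnd ℂ) u * v) := by
  change (fsCoeff (coord (idx x) x) : ℂ) * (v * (starRingEnd ℂ) u) = _
  ring

/-- In every affine coordinate, the coefficient of the metric is `1 / (π (1 + |u|²)²)`. -/
lemma fsInner_chart (i : Fin 2) (u a b : ℂ) :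
    fsInner ((chart i).symm u)
        (mfderiv 𝓘(ℂ, ℂ) 𝓘(ℂ, ℂ) (chart i).symm u a)
        (mfderiv 𝓘(ℂ, ℂ) 𝓘(ℂ, ℂ) (chart i).symm u b) =
      (fsCoeff u : ℂ) * ((starRingEnd ℂ) a * b) := by
  refine (fsInner_apply (ofCoord i u) _ _).trans ?_
  erw [mfderiv_ofCoord i u a, mfderiv_ofCoord i u b]
  split_ifs with h
  · rw [h, coord_ofCoord]
  · have hu : u ≠ 0 := by
      have := mem_U_idx (ofCoord i u)
      exact (ofCoord_mem_U_of_ne (Ne.symm h) u).1 this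
    rw [coord_ofCoord_of_ne (Ne.symm h)]
    have hn : ‖u‖ ≠ 0 := norm_ne_zero_iff.2 hu
    have key : fsCoeff u⁻¹ = fsCoeff u * ‖u‖ ^ 4 := by
      unfold fsCoeff
      have := Real.pi_pos
      rw [norm_inv]
      field_simp
      ring
    have hc : ((‖u‖ : ℂ)) ^ 2 = (starRingEnd ℂ) u * u := (Complex.conj_mul' u).symm
    have hc4 : ((‖u‖ : ℂ)) ^ 4 = ((starRingEnd ℂ) u * u) ^ 2 := by rw [← hc]; ring
    have hu' : (starRingEnd ℂ) u ≠ 0 := (map_ne_zero _).2 hu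
    rw [key]
    push_cast
    rw [hc4]
    simp only [map_mul, map_neg, map_inv₀, map_pow]
    field_simp

/-- The Fubini-Study metric on the complex projective line. -/
def fubiniStudy : HermitianMetric ℂ CP1 where
  inner := fsInner
  conj_symm x u v := by
    refine (congrArg (starRingEnd ℂ) (fsInner_apply x u v)).trans
      (Eq.trans ?_ (fsInner_apply x v u).symm)
    have h (c : ℝ) (u v : ℂ) : (starRingEnd ℂ) ((c : ℂ) * ((starRingEnd ℂ) u * v)) =
        (c : ℂ) * ((starRingEnd ℂ) v * u) := by
      rw [map_mul, map_mul, Complex.conj_conj, Complex.conj_ofReal, mul_comm u]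
    exact h _ u v
  pos_def x v hv := by
    have hv' : (v : ℂ) ≠ 0 := hv
    refine lt_of_lt_of_eq ?_ (congrArg Complex.re (fsInner_apply x v v)).symm
    rw [Complex.conj_mul' (v : ℂ), ← Complex.ofReal_pow, ← Complex.ofReal_mul, Complex.ofReal_re]
    exact mul_pos (fsCoeff_pos _) (pow_pos ((norm_pos_iff (E := ℂ)).2 hv') 2)
  smooth x₀ a b := by
    refine ContDiff.contDiffOn ?_
    have h : (fun u : ℂ ↦ (fsCoeff u : ℂ) * ((starRingEnd ℂ) a * b)) =
        fun u : ℂ ↦ fsInner ((chart (idx x₀)).symm u)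
        (mfderiv 𝓘(ℂ, ℂ) 𝓘(ℂ, ℂ) (chart (idx x₀)).symm u a)
        (mfderiv 𝓘(ℂ, ℂ) 𝓘(ℂ, ℂ) (chart (idx x₀)).symm u b) :=
      funext fun u ↦ (fsInner_chart (idx x₀) u a b).symm
    suffices H : ContDiff ℝ ∞ fun u : ℂ ↦ (fsCoeff u : ℂ) * ((starRingEnd ℂ) a * b) by
      rw [h] at H
      exact H
    exact ContDiff.mul (Complex.ofRealCLM.contDiff.comp contDiff_fsCoeff) contDiff_const

end CP1

end

open MeasureTheory

namespace CP1

/-! A curve with `|df| ≤ 1` cannot be nearly isometric on a small disc, because the sphere is curved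
and the plane is flat. Since `1 - |df|²` is nonnegative, it suffices that its integral over every
disc of radius 1/100 has a uniform positive lower bound; averaging over the centres then bounds the
lost area in a large disc below by a fixed fraction of its area.

The obstruction to isometry is a maximum principle. Let `w` be an affine coordinate of the curve
with `‖w a‖ ≤ 1`. If `|df|` were nearly 1 near `a`, then `w'` would have no zero there, and `Φ = (1
+ conj (w a) * w)² / w'`, up to a constant the reciprocal of the derivative of the coordinate
rotated so that `f a` becomes the origin, would be holomorphic. Near isometry makes `‖Φ‖` smaller on
a circle about `a` than at `a`, by the square of the chordal distance travelled, which is impossible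
(`LocalCurve.exists_le_defect`). Cauchy estimates spread the defect found at one point to a disc of
fixed radius (`LocalCurve.exists_closedBall_le_defect`), and Tonelli performs the averaging
(`mul_volume_closedBall_le_lintegral`). -/

/-! ### Holomorphic curves in affine coordinates. -/

lemma differentiableAt_coord_comp {f : ℂ → CP1} {z : ℂ} {i : Fin 2}
    (hf : MDifferentiableAt 𝓘(ℂ, ℂ) 𝓘(ℂ, ℂ) f z) (hi : f z ∈ U i) :
    DifferentiableAt ℂ (fun y ↦ coord i (f y)) z := by
  have h : MDifferentiableAt 𝓘(ℂ, ℂ) 𝓘(ℂ, ℂ) (chart i) (f z) :=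
    mdifferentiableAt_atlas (H := ℂ) (M := CP1) (Set.mem_range_self i) hi
  exact (h.comp z hf).differentiableAt

/-- The metric has the same coefficient in both charts (`fsInner_chart`), so any chart containing `f
z` may be used, not only the preferred one. -/
lemma normDifferential_sq_eq {f : ℂ → CP1} {z : ℂ} {i : Fin 2}
    (hf : MDifferentiableAt 𝓘(ℂ, ℂ) 𝓘(ℂ, ℂ) f z) (hi : f z ∈ U i) :
    normDifferential fubiniStudy f z ^ 2 =
      fsCoeff (coord i (f z)) * ‖deriv (fun y ↦ coord i (f y)) z‖ ^ 2 := by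
  have hw := differentiableAt_coord_comp hf hi
  have hsymm : MDifferentiableAt 𝓘(ℂ, ℂ) 𝓘(ℂ, ℂ) (chart i).symm (coord i (f z)) :=
    mdifferentiableAt_atlas_symm (H := ℂ) (M := CP1) (Set.mem_range_self i) (Set.mem_univ _)
  have hev : f =ᶠ[nhds z] fun y ↦ (chart i).symm (coord i (f y)) := by
    filter_upwards [hf.continuousAt.preimage_mem_nhds ((isOpen_U i).mem_nhds hi)] with y hy
    exact (ofCoord_coord i (f y) hy).symm
  have hd : mfderiv 𝓘(ℂ, ℂ) 𝓘(ℂ, ℂ) f z (1 : ℂ) =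
      mfderiv 𝓘(ℂ, ℂ) 𝓘(ℂ, ℂ) (chart i).symm (coord i (f z))
        (deriv (fun y ↦ coord i (f y)) z) := by
    rw [hev.mfderiv_eq]
    have := mfderiv_comp (I := 𝓘(ℂ, ℂ)) (I' := 𝓘(ℂ, ℂ)) (I'' := 𝓘(ℂ, ℂ)) z
      (g := (chart i).symm) (f := fun y ↦ coord i (f y)) hsymm hw.mdifferentiableAt
    refine (DFunLike.congr_fun this (1 : ℂ)).trans ?_
    rw [mfderiv_eq_fderiv]
    rfl
  have hz : (chart i).symm (coord i (f z)) = f z := ofCoord_coord i (f z) hi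
  have key := fsInner_chart i (coord i (f z)) (deriv (fun y ↦ coord i (f y)) z)
    (deriv (fun y ↦ coord i (f y)) z)
  rw [Complex.conj_mul', ← Complex.ofReal_pow, ← Complex.ofReal_mul] at key
  have hin : (fsInner (f z) (mfderiv 𝓘(ℂ, ℂ) 𝓘(ℂ, ℂ) f z (1 : ℂ))
      (mfderiv 𝓘(ℂ, ℂ) 𝓘(ℂ, ℂ) f z (1 : ℂ))) =
      ((fsCoeff (coord i (f z)) * ‖deriv (fun y ↦ coord i (f y)) z‖ ^ 2 : ℝ) : ℂ) := by
    rw [← key]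
    generalize mfderiv 𝓘(ℂ, ℂ) 𝓘(ℂ, ℂ) f z (1 : ℂ) = v at hd ⊢
    subst hd
    erw [hz]
    rfl
  have hre : normDifferential fubiniStudy f z =
      √ (fsCoeff (coord i (f z)) * ‖deriv (fun y ↦ coord i (f y)) z‖ ^ 2) := by
    refine congrArg Real.sqrt ((congrArg Complex.re hin).trans (Complex.ofReal_re _))
  rw [hre, Real.sq_sqrt]
  exact mul_nonneg (fsCoeff_pos _).le (sq_nonneg _)

lemma normDifferential_nonneg (f : ℂ → CP1) (z : ℂ) : 0 ≤ normDifferential fubiniStudy f z :=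
  Real.sqrt_nonneg _

lemma continuous_normDifferential_sq {f : ℂ → CP1} (hf : MDifferentiable 𝓘(ℂ, ℂ) 𝓘(ℂ, ℂ) f) :
    Continuous fun z ↦ normDifferential fubiniStudy f z ^ 2 := by
  rw [continuous_iff_continuousAt]
  intro z
  -- The preferred chart may jump from point to point; the index is frozen at `z`.
  have hopen : IsOpen (f ⁻¹' U (idx (f z))) := (isOpen_U _).preimage hf.continuous
  have hz : z ∈ f ⁻¹' U (idx (f z)) := mem_U_idx _
  have hev : (fun y ↦ normDifferential fubiniStudy f y ^ 2) =ᶠ[nhds z] fun y ↦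
      fsCoeff (coord (idx (f z)) (f y)) * ‖deriv (fun y ↦ coord (idx (f z)) (f y)) y‖ ^ 2 := by
    filter_upwards [hopen.mem_nhds hz] with y hy using normDifferential_sq_eq (hf y) hy
  have hdiff : DifferentiableOn ℂ (fun y ↦ coord (idx (f z)) (f y)) (f ⁻¹' U (idx (f z))) :=
    fun y hy ↦ (differentiableAt_coord_comp (hf y) hy).differentiableWithinAt
  refine ContinuousAt.congr ?_ hev.symm
  refine ContinuousAt.mul ?_ ?_
  · exact contDiff_fsCoeff.continuous.continuousAt.comp
      (hdiff.differentiableAt (hopen.mem_nhds hz)).continuousAt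
  · exact (((hdiff.deriv hopen).differentiableAt (hopen.mem_nhds hz)).continuousAt.norm).pow 2

/-! ### A Lipschitz height function on the sphere. -/

/-- The squared modulus of the `i`-th coordinate of a unit vector representing `x`. -/
noncomputable def weight (i : Fin 2) (x : CP1) : ℝ :=
  ‖x.rep i‖ ^ 2 / (‖x.rep 0‖ ^ 2 + ‖x.rep 1‖ ^ 2)

lemma weight_add_weight (x : CP1) : weight 0 x + weight 1 x = 1 := by
  have h : 0 < ‖x.rep 0‖ ^ 2 + ‖x.rep 1‖ ^ 2 := by
    by_cases h0 : x ∈ U 0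
    · have : 0 < ‖x.rep 0‖ := norm_pos_iff.2 h0
      positivity
    · have : 0 < ‖x.rep 1‖ := norm_pos_iff.2 (mem_U_one_of_notMem_U_zero h0)
      positivity
  unfold weight
  field_simp

lemma weight_eq {i : Fin 2} {x : CP1} (hx : x ∈ U i) :
    weight i x = (1 + ‖coord i x‖ ^ 2)⁻¹ := by
  have h : ‖x.rep i‖ ≠ 0 := norm_ne_zero_iff.2 hx
  have h' : 0 < ‖x.rep i‖ := (norm_nonneg _).lt_of_ne' h
  fin_cases i
  all_goals
    simp only [Fin.zero_eta, Fin.mk_one, weight, coord, norm_div] at h h' ⊢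
    have h0 : 0 ≤ ‖x.rep 0‖ := norm_nonneg _
    have h1 : 0 ≤ ‖x.rep 1‖ := norm_nonneg _
    simp only [Fin.rev_zero, Fin.reduceRev, Fin.reduceLast]
    field_simp
  ring

lemma mem_U_of_weight_pos {i : Fin 2} {x : CP1} (h : 0 < weight i x) : x ∈ U i := by
  intro h0
  simp [weight, h0] at h

lemma norm_deriv_le {f : ℂ → CP1} (hf : f ∈ holomorphicCurves fubiniStudy) {z : ℂ} {i : Fin 2}
    (hi : f z ∈ U i) :
    ‖deriv (fun y ↦ coord i (f y)) z‖ ≤ √Real.pi * (1 + ‖coord i (f z)‖ ^ 2) := by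
  have h1 := normDifferential_sq_eq (hf.1 z) hi
  have h2 : normDifferential fubiniStudy f z ^ 2 ≤ 1 :=
    pow_le_one₀ (normDifferential_nonneg f z) (hf.2 z)
  rw [h1, fsCoeff, inv_mul_le_one₀ (by have := Real.pi_pos; positivity)] at h2
  refine le_of_sq_le_sq ?_ (by positivity)
  rwa [mul_pow, Real.sq_sqrt Real.pi_pos.le]

lemma sqrt_pi_le_two : √Real.pi ≤ 2 := by
  rw [Real.sqrt_le_left (by norm_num)]
  linarith [Real.pi_le_four]

/-- The differential of `(1 + ‖w‖²)⁻¹` is at most `2 ‖w‖ ‖w'‖ / (1 + ‖w‖²)²`; then `‖w'‖ ≤ 2 (1 +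
‖w‖²)` and `2 ‖w‖ ≤ 1 + ‖w‖²`. -/
lemma exists_hasFDerivAt_weight {f : ℂ → CP1} (hf : f ∈ holomorphicCurves fubiniStudy) {z : ℂ}
    {i : Fin 2} (hi : f z ∈ U i) :
    ∃ L : ℂ →L[ℝ] ℝ, HasFDerivAt (fun y ↦ weight i (f y)) L z ∧ ‖L‖ ≤ 2 := by
  set w : ℂ → ℂ := fun y ↦ coord i (f y) with hwdef
  have hd : HasDerivAt w (deriv w z) z := (differentiableAt_coord_comp (hf.1 z) hi).hasDerivAt
  have hd' := hd.hasFDerivAt.restrictScalars ℝ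
  have hpos : 0 < 1 + ‖w z‖ ^ 2 := by positivity
  have hn := (hasDerivAt_inv hpos.ne').comp_hasFDerivAt z (hd'.norm_sq.const_add 1)
  have hev : (fun y ↦ weight i (f y)) =ᶠ[nhds z] fun y ↦ (1 + ‖w y‖ ^ 2)⁻¹ := by
    filter_upwards [(hf.1 z).continuousAt.preimage_mem_nhds ((isOpen_U i).mem_nhds hi)] with y hy
    exact weight_eq hy
  refine ⟨_, hn.congr_of_eventuallyEq hev, ContinuousLinearMap.opNorm_le_bound _ (by norm_num)
    fun v ↦ ?_⟩
  have hb : ‖deriv w z‖ ≤ 2 * (1 + ‖w z‖ ^ 2) :=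
    (norm_deriv_le hf hi).trans (mul_le_mul_of_nonneg_right sqrt_pi_le_two hpos.le)
  have hin : |inner ℝ (w z) (v * deriv w z)| ≤ ‖w z‖ * (‖v‖ * (2 * (1 + ‖w z‖ ^ 2))) := by
    refine (abs_real_inner_le_norm _ _).trans ?_
    rw [norm_mul]
    gcongr
  have h2 : 2 * ‖w z‖ ≤ 1 + ‖w z‖ ^ 2 := by nlinarith [sq_nonneg (‖w z‖ - 1)]
  have heq : ‖(-((1 + ‖w z‖ ^ 2) ^ 2)⁻¹ • 2 • (innerSL ℝ) (w z) ∘SL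
      ContinuousLinearMap.restrictScalars ℝ (ContinuousLinearMap.toSpanSingleton ℂ (deriv w z))) v‖ =
      ((1 + ‖w z‖ ^ 2) ^ 2)⁻¹ * (2 * |inner ℝ (w z) (v * deriv w z)|) := by
    rw [smul_apply, smul_apply, norm_smul, norm_neg,
      norm_inv, Real.norm_of_nonneg (by positivity : 0 ≤ (1 + ‖w z‖ ^ 2) ^ 2), nsmul_eq_mul,
      norm_mul]
    simp only [Nat.cast_ofNat, Real.norm_ofNat]
    rfl
  rw [heq, inv_mul_le_iff₀ (by positivity)]
  calc 2 * |inner ℝ (w z) (v * deriv w z)|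
      ≤ 2 * (‖w z‖ * (‖v‖ * (2 * (1 + ‖w z‖ ^ 2)))) := by gcongr
    _ = (2 * ‖w z‖) * (2 * ‖v‖ * (1 + ‖w z‖ ^ 2)) := by ring
    _ ≤ (1 + ‖w z‖ ^ 2) * (2 * ‖v‖ * (1 + ‖w z‖ ^ 2)) := by gcongr
    _ = (1 + ‖w z‖ ^ 2) ^ 2 * (2 * ‖v‖) := by ring

/-- This controls how long the curve stays in one chart. Where chart 0 fails, weight 0 is
differentiated as 1 minus weight 1, so the mean value inequality applies on the whole plane. -/
lemma abs_weight_sub_le {f : ℂ → CP1} (hf : f ∈ holomorphicCurves fubiniStudy) (i : Fin 2)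
    (x y : ℂ) : |weight i (f y) - weight i (f x)| ≤ 2 * ‖y - x‖ := by
  have h0 : ∀ z, ∃ L : ℂ →L[ℝ] ℝ, HasFDerivAt (fun y ↦ weight 0 (f y)) L z ∧ ‖L‖ ≤ 2 := by
    intro z
    by_cases hz : f z ∈ U 0
    · exact exists_hasFDerivAt_weight hf hz
    · obtain ⟨L, hL, hb⟩ := exists_hasFDerivAt_weight hf (mem_U_one_of_notMem_U_zero hz)
      refine ⟨-L, (hL.const_sub 1).congr_of_eventuallyEq (.of_forall fun y ↦ ?_), by rwa [norm_neg]⟩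
      exact eq_sub_of_add_eq (weight_add_weight (f y))
  choose L hL hb using h0
  have key := convex_univ.norm_image_sub_le_of_norm_hasFDerivWithin_le
    (fun z _ ↦ (hL z).hasFDerivWithinAt) (fun z _ ↦ hb z) (Set.mem_univ x) (Set.mem_univ y)
  rw [Real.norm_eq_abs] at key
  fin_cases i
  · exact key
  · have hx := weight_add_weight (f x)
    have hy := weight_add_weight (f y)
    have : weight 1 (f y) - weight 1 (f x) = -(weight 0 (f y) - weight 0 (f x)) := by linarith
    change |weight 1 (f y) - weight 1 (f x)| ≤ _
    rwa [this, abs_neg]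

lemma exists_half_le_weight (x : CP1) : ∃ i, 1 / 2 ≤ weight i x := by
  by_contra! h
  linarith [h 0, h 1, weight_add_weight x]

end CP1

/-! ### Local analysis: a nearly isometric disc is impossible. -/

/-- The data of an affine coordinate of a holomorphic curve with `|df| ≤ 1` near a point at which
the coordinate has modulus at most one. -/
structure LocalCurve (w : ℂ → ℂ) (a : ℂ) : Prop where
  differentiableOn : DifferentiableOn ℂ w (Metric.ball a (1 / 10))
  norm_deriv_le : ∀ z ∈ Metric.ball a (1 / 10), ‖deriv w z‖ ≤ √Real.pi * (1 + ‖w z‖ ^ 2)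
  norm_sq_le : ∀ z ∈ Metric.ball a (1 / 10), ‖w z‖ ^ 2 ≤ 3
  norm_center_le : ‖w a‖ ≤ 1

/-- The defect of `|df| ≤ 1` in an affine coordinate. -/
noncomputable def defect (w : ℂ → ℂ) (z : ℂ) : ℝ :=
  √Real.pi * (1 + ‖w z‖ ^ 2) - ‖deriv w z‖

lemma one_le_sqrt_pi : 1 ≤ √Real.pi := by
  rw [Real.one_le_sqrt]
  linarith [Real.pi_gt_three]

namespace LocalCurve

variable {w : ℂ → ℂ} {a : ℂ}

lemma norm_deriv_le_eight (h : LocalCurve w a) {z : ℂ} (hz : z ∈ Metric.ball a (1 / 10)) :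
    ‖deriv w z‖ ≤ 8 := by
  have h1 := h.norm_deriv_le z hz
  have h2 := h.norm_sq_le z hz
  calc ‖deriv w z‖ ≤ √Real.pi * (1 + ‖w z‖ ^ 2) := h1
    _ ≤ 2 * (1 + 3) := by gcongr; exact CP1.sqrt_pi_le_two
    _ = 8 := by norm_num

lemma differentiableAt (h : LocalCurve w a) {z : ℂ} (hz : z ∈ Metric.ball a (1 / 10)) :
    DifferentiableAt ℂ w z :=
  h.differentiableOn.differentiableAt (Metric.isOpen_ball.mem_nhds hz)

lemma differentiableAt_deriv (h : LocalCurve w a) {z : ℂ} (hz : z ∈ Metric.ball a (1 / 10)) :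
    DifferentiableAt ℂ (deriv w) z :=
  (h.differentiableOn.deriv Metric.isOpen_ball).differentiableAt (Metric.isOpen_ball.mem_nhds hz)

/-- Cauchy's estimate for `w'` on a circle of radius 1/40: `320 = 8 / (1/40)`. -/
lemma norm_deriv_deriv_le (h : LocalCurve w a) {z : ℂ} (hz : z ∈ Metric.closedBall a (1 / 20)) :
    ‖deriv (deriv w) z‖ ≤ 320 := by
  have hsub : Metric.closedBall z (1 / 40) ⊆ Metric.ball a (1 / 10) :=
    Metric.closedBall_subset_ball' (by rw [Metric.mem_closedBall] at hz; linarith)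
  refine (Complex.norm_deriv_le_of_forall_mem_sphere_norm_le (R := 1 / 40) (C := 8) (by norm_num)
    ?_ fun y hy ↦ ?_).trans (by norm_num)
  · exact ((h.differentiableOn.deriv Metric.isOpen_ball).mono hsub).diffContOnCl_ball subset_rfl
  · exact h.norm_deriv_le_eight (hsub (Metric.sphere_subset_closedBall hy))

lemma closedBall_subset {a : ℂ} :
    Metric.closedBall a (1 / 20) ⊆ Metric.ball a (1 / 10) :=
  Metric.closedBall_subset_ball (by norm_num)

lemma norm_deriv_sub_le (h : LocalCurve w a) {x y : ℂ} (hx : x ∈ Metric.closedBall a (1 / 20))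
    (hy : y ∈ Metric.closedBall a (1 / 20)) : ‖deriv w y - deriv w x‖ ≤ 320 * ‖y - x‖ :=
  (convex_closedBall a _).norm_image_sub_le_of_norm_deriv_le
    (fun _ hz ↦ h.differentiableAt_deriv (closedBall_subset hz))
    (fun _ hz ↦ h.norm_deriv_deriv_le hz) hx hy

lemma norm_sub_le (h : LocalCurve w a) {x y : ℂ} (hx : x ∈ Metric.closedBall a (1 / 20))
    (hy : y ∈ Metric.closedBall a (1 / 20)) : ‖w y - w x‖ ≤ 8 * ‖y - x‖ :=
  (convex_closedBall a _).norm_image_sub_le_of_norm_deriv_le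
    (fun _ hz ↦ h.differentiableAt (closedBall_subset hz))
    (fun _ hz ↦ h.norm_deriv_le_eight (closedBall_subset hz)) hx hy

/-- The derivative term contributes 320 and the term in `‖w‖²` at most `2 * 32`; 1000 is generous.
-/
lemma defect_sub_le (h : LocalCurve w a) {x y : ℂ} (hx : x ∈ Metric.closedBall a (1 / 20))
    (hy : y ∈ Metric.closedBall a (1 / 20)) : defect w x - defect w y ≤ 1000 * ‖y - x‖ := by
  have h1 := h.norm_deriv_sub_le hx hy
  have h2 := h.norm_sub_le hx hy
  have h3 := (norm_sub_norm_le (deriv w y) (deriv w x)).trans h1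
  have h4 := (norm_sub_norm_le (w x) (w y)).trans_eq (norm_sub_rev _ _) |>.trans h2
  have hwx : ‖w x‖ ≤ 2 := by nlinarith [h.norm_sq_le x (closedBall_subset hx), norm_nonneg (w x)]
  have hwy : ‖w y‖ ≤ 2 := by nlinarith [h.norm_sq_le y (closedBall_subset hy), norm_nonneg (w y)]
  have h5 : ‖w x‖ ^ 2 - ‖w y‖ ^ 2 ≤ 32 * ‖y - x‖ := by
    have : ‖w x‖ ^ 2 - ‖w y‖ ^ 2 = (‖w x‖ - ‖w y‖) * (‖w x‖ + ‖w y‖) := by ring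
    rw [this]
    calc _ ≤ (8 * ‖y - x‖) * (‖w x‖ + ‖w y‖) := by gcongr
      _ ≤ (8 * ‖y - x‖) * (2 + 2) := by gcongr
      _ = _ := by ring
  have h6 : √Real.pi * (‖w x‖ ^ 2 - ‖w y‖ ^ 2) ≤ 2 * (32 * ‖y - x‖) := by
    calc _ ≤ √Real.pi * (32 * ‖y - x‖) := by gcongr
      _ ≤ _ := by gcongr; exact CP1.sqrt_pi_le_two
  have : defect w x - defect w y = √Real.pi * (‖w x‖ ^ 2 - ‖w y‖ ^ 2) +
      (‖deriv w y‖ - ‖deriv w x‖) := by unfold defect; ring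
  rw [this]
  linarith [norm_nonneg (y - x)]

/-- The mean value inequality for `w` minus its linear part at `a`. It makes `w` move a definite
distance once `w'` at `a` is bounded below. -/
lemma mul_norm_sub_le (h : LocalCurve w a) {z : ℂ} (hz : ‖z - a‖ = 1 / 1000) :
    ‖deriv w a‖ * (1 / 1000) - 320 * (1 / 1000) ^ 2 ≤ ‖w z - w a‖ := by
  have hsub : Metric.closedBall a (1 / 1000) ⊆ Metric.closedBall a (1 / 20) :=
    Metric.closedBall_subset_closedBall (by norm_num)
  have ha : a ∈ Metric.closedBall a (1 / 20) := Metric.mem_closedBall_self (by norm_num)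
  have key := (convex_closedBall a (1 / 1000)).norm_image_sub_le_of_norm_deriv_le
    (f := fun y ↦ w y - deriv w a * y) (C := 320 * (1 / 1000)) (x := a) (y := z)
    (fun y hy ↦ (h.differentiableAt (closedBall_subset (hsub hy))).sub
      (differentiableAt_id.const_mul _))
    (fun y hy ↦ ?_) (Metric.mem_closedBall_self (by norm_num))
    (by rw [mem_closedBall_iff_norm, hz])
  · have e : w z - deriv w a * z - (w a - deriv w a * a) =
        (w z - w a) - deriv w a * (z - a) := by ring
    simp only [e] at key
    have h2 := norm_sub_norm_le (deriv w a * (z - a)) (w z - w a)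
    rw [norm_sub_rev (deriv w a * (z - a)), norm_mul] at h2
    rw [hz] at h2 key
    linarith
  · have hd := ((h.differentiableAt (closedBall_subset (hsub hy))).hasDerivAt.sub
      ((hasDerivAt_id y).const_mul (deriv w a))).deriv
    rw [mul_one] at hd
    have h3 : ‖deriv w y - deriv w a‖ ≤ 320 * (1 / 1000) := by
      refine (h.norm_deriv_sub_le ha (hsub hy)).trans ?_
      rw [mem_closedBall_iff_norm] at hy
      gcongr
    rw [← hd] at h3
    exact h3

/-- Lagrange's identity for the vectors `(1, u)` and `(1, v)`: the subtracted term is the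
Cauchy–Schwarz gap, from which the contradiction with isometry comes. -/
lemma norm_one_add_conj_mul_sq (u v : ℂ) :
    ‖1 + (starRingEnd ℂ) u * v‖ ^ 2 = (1 + ‖u‖ ^ 2) * (1 + ‖v‖ ^ 2) - ‖v - u‖ ^ 2 := by
  simp only [← Complex.normSq_eq_norm_sq, Complex.normSq_apply]
  simp
  ring

/-- A holomorphic curve cannot be isometric on a disc. -/
lemma exists_le_defect (h : LocalCurve w a) :
    ∃ z ∈ Metric.closedBall a (1 / 1000), 1 / 10 ^ 9 ≤ defect w z := by
  have hsub : Metric.closedBall a (1 / 1000) ⊆ Metric.ball a (1 / 10) :=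
    Metric.closedBall_subset_ball (by norm_num)
  have ha : a ∈ Metric.closedBall a (1 / 1000) := Metric.mem_closedBall_self (by norm_num)
  have hpi := one_le_sqrt_pi
  by_contra! hcon
  have hne : ∀ z ∈ Metric.closedBall a (1 / 1000), deriv w z ≠ 0 := by
    intro z hz h0
    have := hcon z hz
    rw [defect, h0, norm_zero, sub_zero] at this
    nlinarith [sq_nonneg ‖w z‖]
  have hda : 1 / 2 ≤ ‖deriv w a‖ := by
    have := hcon a ha
    rw [defect] at this
    nlinarith [sq_nonneg ‖w a‖]
  set Φ : ℂ → ℂ := fun z ↦ (1 + (starRingEnd ℂ) (w a) * w z) ^ 2 / deriv w z with hΦ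
  have hdiff : DifferentiableOn ℂ Φ (Metric.closedBall a (1 / 1000)) := by
    intro z hz
    refine DifferentiableAt.differentiableWithinAt (DifferentiableAt.div ?_
      (h.differentiableAt_deriv (hsub hz)) (hne z hz))
    exact (((h.differentiableAt (hsub hz)).const_mul _).const_add 1).pow 2
  -- The maximum principle supplies a boundary point where `‖Φ‖` is at least its value at the
  -- centre.
  obtain ⟨z, hz, hmax⟩ := Complex.exists_mem_frontier_isMaxOn_norm Metric.isBounded_ball
    ⟨a, Metric.mem_ball_self (by norm_num : (0 : ℝ) < 1 / 1000)⟩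
    (hdiff.diffContOnCl_ball subset_rfl)
  rw [frontier_ball a (by norm_num), mem_sphere_iff_norm] at hz
  have hzm : z ∈ Metric.closedBall a (1 / 1000) := by rw [mem_closedBall_iff_norm, hz]
  have hle : ‖Φ a‖ ≤ ‖Φ z‖ := hmax (by rwa [closure_ball a (by norm_num)])
  have hPa : ‖Φ a‖ = (1 + ‖w a‖ ^ 2) ^ 2 / ‖deriv w a‖ := by
    simp only [hΦ, norm_div, norm_pow]
    rw [norm_one_add_conj_mul_sq]
    simp
    ring
  have hPz : ‖Φ z‖ = ((1 + ‖w a‖ ^ 2) * (1 + ‖w z‖ ^ 2) - ‖w z - w a‖ ^ 2) / ‖deriv w z‖ := by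
    simp only [hΦ, norm_div, norm_pow]
    rw [norm_one_add_conj_mul_sq]
  have hz0 : 0 < ‖deriv w z‖ := norm_pos_iff.2 (hne z hzm)
  have ha0 : 0 < ‖deriv w a‖ := norm_pos_iff.2 (hne a ha)
  have hAle : ‖w a‖ ^ 2 ≤ 1 := pow_le_one₀ (norm_nonneg _) h.norm_center_le
  have hba := h.norm_deriv_le a (hsub ha)
  -- `(1/2) / 1000 - 320 / 10⁶ = 1.8 / 10⁴`.
  have hdist : 1 / 10000 ≤ ‖w z - w a‖ := by linarith [h.mul_norm_sub_le hz]
  have hdsq : (1 / 10000) ^ 2 ≤ ‖w z - w a‖ ^ 2 := by gcongr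
  have hdef := hcon z hzm
  rw [hPa, hPz, div_le_div_iff₀ ha0 hz0] at hle
  rw [defect] at hdef
  set A := 1 + ‖w a‖ ^ 2 with hA
  set B := 1 + ‖w z‖ ^ 2
  set D := ‖w z - w a‖ ^ 2
  have hA1 : 1 ≤ A := by rw [hA]; linarith [sq_nonneg ‖w a‖]
  have hA2 : A ≤ 2 := by linarith
  -- The sign is needed below to replace `‖deriv w a‖` by its upper bound `√π * A`.
  have hABD : 0 ≤ A * B - D := by
    by_contra! hneg
    nlinarith [mul_neg_of_neg_of_pos hneg ha0, mul_pos (pow_pos (zero_lt_one.trans_le hA1) 2) hz0]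
  have h1 : A * (A * ‖deriv w z‖) ≤ A * (√Real.pi * (A * B - D)) := by
    calc A * (A * ‖deriv w z‖) = A ^ 2 * ‖deriv w z‖ := by ring
      _ ≤ (A * B - D) * ‖deriv w a‖ := hle
      _ ≤ (A * B - D) * (√Real.pi * A) := by gcongr
      _ = _ := by ring
  have h2 : A * ‖deriv w z‖ ≤ √Real.pi * (A * B - D) := le_of_mul_le_mul_left h1 (by linarith)
  -- The gap `D` forces a defect at `z`: the left side is at least `10⁻⁸`, the right side at most `2
  -- * 10⁻⁹`.
  have h3 : √Real.pi * D ≤ A * (√Real.pi * B - ‖deriv w z‖) := by linarith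
  have h4 : A * (√Real.pi * B - ‖deriv w z‖) ≤ 2 * (1 / 10 ^ 9) := by
    calc _ ≤ A * (1 / 10 ^ 9) := by gcongr
      _ ≤ _ := by gcongr
  have h5 : 1 * (1 / 10000) ^ 2 ≤ √Real.pi * D := by gcongr
  norm_num at h4 h5
  linarith

lemma exists_closedBall_le_defect (h : LocalCurve w a) :
    ∃ z ∈ Metric.closedBall a (1 / 1000), ∀ y ∈ Metric.closedBall z (1 / 10 ^ 13),
      1 / 10 ^ 10 ≤ 1 - CP1.fsCoeff (w y) * ‖deriv w y‖ ^ 2 := by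
  obtain ⟨z, hz, hdef⟩ := h.exists_le_defect
  refine ⟨z, hz, fun y hy ↦ ?_⟩
  rw [Metric.mem_closedBall] at hz hy
  have hz' : z ∈ Metric.closedBall a (1 / 20) := by rw [Metric.mem_closedBall]; linarith
  have hy' : y ∈ Metric.closedBall a (1 / 20) := by
    rw [Metric.mem_closedBall]
    linarith [dist_triangle y z a]
  have h1 := h.defect_sub_le hz' hy'
  rw [← dist_eq_norm] at h1
  -- The Lipschitz bound leaves `10⁻⁹ - 1000 * 10⁻¹³ = 9 * 10⁻¹⁰`.
  have h2 : 8 * (1 / 10 ^ 10) ≤ defect w y := by norm_num at *; linarith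
  rw [defect] at h2
  set G := √Real.pi * (1 + ‖w y‖ ^ 2) with hG
  have hG1 : 1 ≤ G := by nlinarith [one_le_sqrt_pi, sq_nonneg ‖w y‖]
  have hG8 : G ≤ 8 := by
    calc G ≤ 2 * (1 + 3) := by
          rw [hG]; gcongr; exacts [CP1.sqrt_pi_le_two, h.norm_sq_le y (closedBall_subset hy')]
      _ = 8 := by norm_num
  have hfs : CP1.fsCoeff (w y) = (G ^ 2)⁻¹ := by
    rw [CP1.fsCoeff, hG, mul_pow, Real.sq_sqrt Real.pi_pos.le]
  rw [hfs, ← sub_nonneg]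
  -- With `t = ‖deriv w y‖ / G ≤ 1`: `1 - t² ≥ 1 - t ≥ 8 * 10⁻¹⁰ / G ≥ 10⁻¹⁰`, as `G ≤ 8`.
  have h3 : 0 ≤ (G - ‖deriv w y‖ - 8 * (1 / 10 ^ 10)) * G := mul_nonneg (by linarith) (by linarith)
  have h4 : ‖deriv w y‖ ^ 2 ≤ ‖deriv w y‖ * G := by
    rw [sq]; gcongr; linarith
  have h5 : 1 / 10 ^ 10 * G ^ 2 ≤ 8 * (1 / 10 ^ 10) * G := by
    nlinarith
  have h6 : (G ^ 2)⁻¹ * ‖deriv w y‖ ^ 2 ≤ 1 - 1 / 10 ^ 10 := by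
    rw [inv_mul_le_iff₀ (by positivity)]
    nlinarith
  linarith

end LocalCurve

/-! ### A definite loss of area in every small disc. -/

/-- The larger weight is at least 1/2 at `a`, hence at least `1/2 - 2/10 ≥ 1/4` on the ball, which
means `‖w‖² ≤ 3`. -/
lemma CP1.exists_localCurve {f : ℂ → CP1} (hf : f ∈ holomorphicCurves fubiniStudy) (a : ℂ) :
    ∃ i, LocalCurve (fun z ↦ coord i (f z)) a ∧ ∀ z ∈ Metric.ball a (1 / 10), f z ∈ U i := by
  obtain ⟨i, hi⟩ := exists_half_le_weight (f a)
  have hw : ∀ z ∈ Metric.ball a (1 / 10), 1 / 4 ≤ weight i (f z) := by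
    intro z hz
    have := abs_le.1 (abs_weight_sub_le hf i a z)
    rw [mem_ball_iff_norm] at hz
    linarith
  have hU : ∀ z ∈ Metric.ball a (1 / 10), f z ∈ U i := fun z hz ↦
    mem_U_of_weight_pos (by linarith [hw z hz])
  have ha : a ∈ Metric.ball a (1 / 10) := Metric.mem_ball_self (by norm_num)
  refine ⟨i, ⟨fun z hz ↦ (differentiableAt_coord_comp (hf.1 z) (hU z hz)).differentiableWithinAt,
    fun z hz ↦ norm_deriv_le hf (hU z hz), fun z hz ↦ ?_, ?_⟩, hU⟩
  · have := hw z hz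
    rw [weight_eq (hU z hz), le_inv_comm₀ (by norm_num) (by positivity)] at this
    norm_num at this
    linarith
  · rw [weight_eq (hU a ha), le_inv_comm₀ (by norm_num) (by positivity)] at hi
    refine le_of_sq_le_sq ?_ zero_le_one
    norm_num at hi ⊢
    nlinarith [norm_nonneg (coord i (f a))]

/-- A definite part of each disc of radius `1 / 100` is lost. -/
lemma CP1.le_lintegral_one_sub_normDifferential_sq {f : ℂ → CP1}
    (hf : f ∈ holomorphicCurves fubiniStudy) (a : ℂ) :
    ENNReal.ofReal (Real.pi / 10 ^ 36) ≤ ∫⁻ z in Metric.closedBall a (1 / 100),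
      ENNReal.ofReal (1 - normDifferential fubiniStudy f z ^ 2) := by
  obtain ⟨i, hloc, hU⟩ := exists_localCurve hf a
  obtain ⟨z, hz, hle⟩ := hloc.exists_closedBall_le_defect
  rw [Metric.mem_closedBall] at hz
  have hsub : Metric.closedBall z (1 / 10 ^ 13) ⊆ Metric.closedBall a (1 / 100) :=
    Metric.closedBall_subset_closedBall' (by norm_num at *; linarith)
  calc ENNReal.ofReal (Real.pi / 10 ^ 36)
      = ENNReal.ofReal (1 / 10 ^ 10) * volume (Metric.closedBall z (1 / 10 ^ 13)) := by
        rw [Complex.volume_closedBall, ← ENNReal.ofReal_pow (by norm_num),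
          ← ENNReal.ofReal_coe_nnreal, NNReal.coe_real_pi, ← ENNReal.ofReal_mul (by norm_num),
          ← ENNReal.ofReal_mul (by norm_num)]
        congr 1
        ring
    _ = ∫⁻ _ in Metric.closedBall z (1 / 10 ^ 13), ENNReal.ofReal (1 / 10 ^ 10) := by
        rw [setLIntegral_const]
    _ ≤ ∫⁻ y in Metric.closedBall z (1 / 10 ^ 13),
          ENNReal.ofReal (1 - normDifferential fubiniStudy f y ^ 2) := by
        refine setLIntegral_mono' Metric.isClosed_closedBall.measurableSet fun y hy ↦ ?_
        have hy' : f y ∈ U i := hU y (Metric.closedBall_subset_ball (by norm_num) (hsub hy))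
        rw [normDifferential_sq_eq (hf.1 y) hy']
        exact ENNReal.ofReal_le_ofReal (hle y hy)
    _ ≤ _ := lintegral_mono_set hsub

/-! ### Averaging over centres and the bound on the density. -/

/-- If the integral of `D` over each disc of radius `r` is at least `c`, then the integral of `D`
over a large disc is proportional to its area. -/
lemma mul_volume_closedBall_le_lintegral {D : ℂ → ℝ≥0∞} (hD : Measurable D) {c : ℝ≥0∞} {r : ℝ}
    (h : ∀ a, c ≤ ∫⁻ z in Metric.closedBall a r, D z) (R : ℝ) :
    c * volume (Metric.closedBall (0 : ℂ) R) ≤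
      volume (Metric.closedBall (0 : ℂ) r) * ∫⁻ z in Metric.closedBall (0 : ℂ) (R + r), D z := by
  -- Double counting of pairs of a centre `a` in the disc of radius `R` and a point `z` within `r`
  -- of `a`, weighted by `D z`. After Tonelli, each `z` is counted with at most the area of a disc
  -- of radius `r`, and only if `‖z‖ ≤ R + r`.
  set K : ℂ → ℂ → ℝ≥0∞ := fun a z ↦ (Metric.closedBall (0 : ℂ) R).indicator 1 a *
    ((Metric.closedBall a r).indicator 1 z * D z) with hK
  have hmeas : Measurable (Function.uncurry K) := by
    have h1 : MeasurableSet {p : ℂ × ℂ | p.2 ∈ Metric.closedBall p.1 r} := by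
      simp only [Metric.mem_closedBall]
      exact (isClosed_le (by fun_prop) (by fun_prop)).measurableSet
    refine Measurable.mul ((measurable_one.indicator
      Metric.isClosed_closedBall.measurableSet).comp measurable_fst) (Measurable.mul ?_
      (hD.comp measurable_snd))
    exact (measurable_one.indicator h1 : Measurable fun p : ℂ × ℂ ↦
      {p : ℂ × ℂ | p.2 ∈ Metric.closedBall p.1 r}.indicator (1 : ℂ × ℂ → ℝ≥0∞) p)
  calc c * volume (Metric.closedBall (0 : ℂ) R)
      = ∫⁻ _ in Metric.closedBall (0 : ℂ) R, c := by rw [setLIntegral_const]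
    _ ≤ ∫⁻ a in Metric.closedBall (0 : ℂ) R, ∫⁻ z in Metric.closedBall a r, D z :=
        lintegral_mono fun a ↦ h a
    _ = ∫⁻ a, ∫⁻ z, K a z := by
        rw [← lintegral_indicator Metric.isClosed_closedBall.measurableSet]
        refine lintegral_congr fun a ↦ ?_
        by_cases ha : a ∈ Metric.closedBall (0 : ℂ) R
        · simp only [hK, Set.indicator_of_mem ha, Pi.one_apply, one_mul]
          rw [← lintegral_indicator Metric.isClosed_closedBall.measurableSet]
          refine lintegral_congr fun z ↦ ?_
          by_cases hz : z ∈ Metric.closedBall a r <;> simp [hz, Set.indicator]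
        · simp [hK, Set.indicator_of_notMem ha]
    _ = ∫⁻ z, ∫⁻ a, K a z := lintegral_lintegral_swap hmeas.aemeasurable
    _ ≤ ∫⁻ z, (Metric.closedBall (0 : ℂ) (R + r)).indicator
          (fun z ↦ volume (Metric.closedBall (0 : ℂ) r) * D z) z := by
        refine lintegral_mono fun z ↦ ?_
        by_cases hz : z ∈ Metric.closedBall (0 : ℂ) (R + r)
        · rw [Set.indicator_of_mem hz]
          calc ∫⁻ a, K a z ≤ ∫⁻ a, (Metric.closedBall z r).indicator (fun _ ↦ D z) a := by
                refine lintegral_mono fun a ↦ ?_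
                simp only [hK, Set.indicator, Metric.mem_closedBall, Pi.one_apply, dist_comm z a]
                split_ifs <;> simp
            _ = volume (Metric.closedBall (0 : ℂ) r) * D z := by
                rw [lintegral_indicator Metric.isClosed_closedBall.measurableSet,
                  setLIntegral_const, mul_comm, Complex.volume_closedBall,
                  Complex.volume_closedBall]
        · rw [Set.indicator_of_notMem hz, nonpos_iff_eq_zero]
          refine (lintegral_congr fun a ↦ ?_).trans lintegral_zero
          simp only [hK]
          by_cases ha : a ∈ Metric.closedBall (0 : ℂ) R
          · have : z ∉ Metric.closedBall a r := by
              intro hza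
              rw [Metric.mem_closedBall] at *
              exact hz ((dist_triangle z a 0).trans (by linarith))
            simp [Set.indicator_of_notMem this]
          · simp [Set.indicator_of_notMem ha]
    _ = _ := by
        rw [lintegral_indicator Metric.isClosed_closedBall.measurableSet,
          lintegral_const_mul _ hD]

lemma volume_closedBall_eq_ofReal {R : ℝ} (hR : 0 ≤ R) :
    volume (Metric.closedBall (0 : ℂ) R) = ENNReal.ofReal (Real.pi * R ^ 2) := by
  rw [Complex.volume_closedBall, ← ENNReal.ofReal_pow hR, ← ENNReal.ofReal_coe_nnreal,
    NNReal.coe_real_pi, ← ENNReal.ofReal_mul (by positivity), mul_comm]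

lemma CP1.packingDensity_le {f : ℂ → CP1} (hf : f ∈ holomorphicCurves fubiniStudy) :
    packingDensity fubiniStudy f ≤ ENNReal.ofReal (1 - 10 ^ (-100 : ℤ)) := by
  have hcont := continuous_normDifferential_sq hf.1
  set n : ℂ → ℝ := fun z ↦ normDifferential fubiniStudy f z ^ 2 with hn
  have hn1 : ∀ z, n z ≤ 1 := fun z ↦ pow_le_one₀ (normDifferential_nonneg f z) (hf.2 z)
  refine Filter.limsup_le_of_le (by isBoundedDefault) ?_
  filter_upwards [Filter.eventually_ge_atTop 1] with R hR
  have hpi := Real.pi_pos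
  set B := Metric.closedBall (0 : ℂ) R
  have hvB : volume B = ENNReal.ofReal (Real.pi * R ^ 2) := volume_closedBall_eq_ofReal (by linarith)
  have hDm : Measurable fun z ↦ ENNReal.ofReal (1 - n z) :=
    (measurable_const.sub hcont.measurable).ennreal_ofReal
  have hsum : (∫⁻ z in B, ENNReal.ofReal (n z)) + ∫⁻ z in B, ENNReal.ofReal (1 - n z) =
      ENNReal.ofReal (Real.pi * R ^ 2) := by
    rw [← lintegral_add_right _ hDm, ← hvB, ← setLIntegral_one]
    refine lintegral_congr fun z ↦ ?_
    rw [← ENNReal.ofReal_add (sq_nonneg _) (by linarith [hn1 z])]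
    simp [hn]
  -- Centres stay within `R - 1/100`, so that the small discs lie in `B`.
  have hlow := mul_volume_closedBall_le_lintegral hDm
    (le_lintegral_one_sub_normDifferential_sq hf) (R - 1 / 100)
  rw [sub_add_cancel, volume_closedBall_eq_ofReal (by linarith),
    volume_closedBall_eq_ofReal (by norm_num)] at hlow
  have hfin : ∫⁻ z in B, ENNReal.ofReal (1 - n z) ≠ ⊤ := by
    refine ne_top_of_le_ne_top ENNReal.ofReal_ne_top (hsum ▸ le_add_self)
  have hfin' : ∫⁻ z in B, ENNReal.ofReal (n z) ≠ ⊤ := by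
    refine ne_top_of_le_ne_top ENNReal.ofReal_ne_top (hsum ▸ le_self_add)
  lift (∫⁻ z in B, ENNReal.ofReal (1 - n z)) to NNReal using hfin with d hd
  change (∫⁻ z in B, ENNReal.ofReal (n z)) / ENNReal.ofReal (Real.pi * R ^ 2) ≤ _
  lift (∫⁻ z in B, ENNReal.ofReal (n z)) to NNReal using hfin' with e he
  rw [← ENNReal.ofReal_coe_nnreal, ← ENNReal.ofReal_coe_nnreal,
    ← ENNReal.ofReal_add e.coe_nonneg d.coe_nonneg, ENNReal.ofReal_eq_ofReal_iff (by positivity) (by positivity)]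
    at hsum
  rw [← hd, ← ENNReal.ofReal_coe_nnreal, ← ENNReal.ofReal_mul (by positivity),
    ← ENNReal.ofReal_mul (by positivity), ENNReal.ofReal_le_ofReal_iff (by positivity)] at hlow
  rw [← ENNReal.ofReal_coe_nnreal, ← ENNReal.ofReal_div_of_pos (by positivity)]
  refine ENNReal.ofReal_le_ofReal ?_
  rw [div_le_iff₀ (by positivity), zpow_neg]
  have h1 : (R / 2) ^ 2 ≤ (R - 1 / 100) ^ 2 := by gcongr; linarith
  have h2 : Real.pi / 10 ^ 36 * (Real.pi * (R / 2) ^ 2) ≤ Real.pi * (1 / 100) ^ 2 * d :=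
    le_trans (by gcongr) hlow
  have h3 : Real.pi * (R ^ 2 * Real.pi / (4 * 10 ^ 36)) ≤ Real.pi * ((1 / 100) ^ 2 * d) := by
    linarith
  have h4 := le_of_mul_le_mul_left h3 hpi
  -- The lost fraction is at least `1 / (4 * 10³⁶)` even after discarding the factor `(1/100)²`,
  -- well above `10⁻¹⁰⁰`.
  have h5 : ((10 : ℝ) ^ (100 : ℤ))⁻¹ * (Real.pi * R ^ 2) ≤ d := by
    have h6 : ((10 : ℝ) ^ (100 : ℤ))⁻¹ ≤ 1 / (4 * 10 ^ 36) := by norm_num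
    calc _ ≤ 1 / (4 * 10 ^ 36) * (Real.pi * R ^ 2) := by gcongr
      _ = R ^ 2 * Real.pi / (4 * 10 ^ 36) := by ring
      _ ≤ (1 / 100) ^ 2 * d := h4
      _ ≤ 1 * d := by gcongr; norm_num
      _ = d := one_mul _
  linarith

theorem mainTheorem4 :
    holomorphicCapacity CP1.fubiniStudy ≤ ENNReal.ofReal (1 - 10 ^ (-100 : ℤ)) :=
  iSup₂_le fun _ hf ↦ CP1.packingDensity_le hf
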